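/- Let $1\le m\le n$ be integers. $PF(m,n)$ is the set of parking functions of $m$ cars and $n$ spots: sequences $\pi=(\pi_1,\dots,\pi_m)\in\{1,\dots,n\}^m$ such that, when cars $1,\dots,m$ arrive one after the other and car $i$ takes the first free spot among $\pi_i,\pi_i+1,\dots,n$, all cars park. Let $\mathrm{slev}(\pi)$ be the number of $i$ with $\pi_i\le n-m+1$ and let $\mathrm{lel}(\pi)$ be the number of $i$ with $\pi_i=\pi_1$. $\mathcal F(m,n)$ is the set of rooted forests whose roots are labeled $01,02,\dots,0(n-m+1)$ and whose non-root vertices are labeled $1,\dots,m$: acyclic graphs on these $n+1$ vertices such that every component contains exactly one of the roots. For $F\in\mathcal F(m,n)$ let $\deg(0)$ be the total number of children of all roots and let $\deg(p)$ be the number of children of the parent $p$ of vertex $1$. Then the following hold. 1. For all integers $s,t\ge 0$, $$\#\{F\in\mathcal F(m,n):\deg(0)=s,\ \deg(p)=t\}=\#\{\pi\in PF(m,n):\mathrm{slev}(\pi)=s,\ \mathrm{lel}(\pi)=t\}.$$ 2. For all integers $s,t\ge 1$, $$\#\{F\in\mathcal F(m,n):\deg(0)=s,\ \deg(p)=t\}=\binom{m-2}{s-1,\,t-1,\,m-s-t}(n-m+1)^s(m-1)^{m-s-t+1}+\binom{m-1}{t-1,\,s-t,\,m-s}\,s\,(n-m+1)(n-m)^{s-t}m^{m-s-1},$$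 where $\binom{k}{a,b,c}=\frac{k!}{a!\,b!\,c!}$ for $a+b+c=k$ and $a,b,c\ge 0$; a multinomial coefficient with a negative lower entry is $0$, and so is then the whole term; and $0^0=1$. 3. As rational functions in the indeterminates $x,y$, $$\sum_{F\in\mathcal F(m,n)}x^{\deg(0)}y^{\deg(p)}=\sum_{\pi\in PF(m,n)}x^{\mathrm{slev}(\pi)}y^{\mathrm{lel}(\pi)}$$ and both are equal to $$(n-m+1)\,xy\left[(m-1)\big((n-m+1)x+y+m-1\big)^{m-2}+\big(xy+(n-m)x+1\big)\big(xy+(n-m)x+m\big)^{m-2}\right].$$ -/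

import Mathlib

namespace ParkingForest

open scoped Classical

/-- A preference list `π` of `m` cars for `n` spots is a parking function if all cars park:
`σ i` is the spot taken by car `i`, the first spot at or after its preferred spot `π i` which is
not taken by an earlier car. Cars and spots are numbered from `0` here, so that `i : Fin m` is
car `i + 1` and `j : Fin n` is spot `j + 1`. -/
def IsParkingFunction {m n : ℕ} (π : Fin m → Fin n) : Prop :=
  ∃ σ : Fin m → Fin n, ∀ i, IsLeast {j : Fin n | π i ≤ j ∧ ∀ k < i, σ k ≠ j} (σ i)

/-- The set `PF(m, n)` of parking functions of `m` cars and `n` spots. -/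
abbrev PF (m n : ℕ) : Type := {π : Fin m → Fin n // IsParkingFunction π}

noncomputable instance (m n : ℕ) : Fintype (PF m n) := Fintype.ofFinite _

/-- Size of the level set: the number of cars whose preferred spot is in `{1, …, n - m + 1}`. -/
noncomputable def slev {m n : ℕ} (π : PF m n) : ℕ :=
  (Finset.univ.filter fun i : Fin m => (π.1 i : ℕ) + 1 ≤ n - m + 1).card

/-- Leading elements: the number of cars whose preferred spot is that of the first car. -/
noncomputable def lel {m n : ℕ} (hm : 1 ≤ m) (π : PF m n) : ℕ :=
  (Finset.univ.filter fun i : Fin m => π.1 i = π.1 ⟨0, hm⟩).card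

/-- The vertices of the forests: the roots `01, …, 0(n - m + 1)` (left summand) and the non-root
vertices `1, …, m` (right summand, `Sum.inr i` being the vertex labelled `i + 1`). -/
abbrev Vertex (m n : ℕ) : Type := Fin (n - m + 1) ⊕ Fin m

/-- The set `F(m, n)` of rooted forests: acyclic graphs on the above vertices such that every
component contains exactly one of the specified roots. -/
structure RootedForest (m n : ℕ) where
  graph : SimpleGraph (Vertex m n)
  acyclic : graph.IsAcyclic
  existsUnique_root : ∀ v, ∃! r : Fin (n - m + 1), graph.Reachable (Sum.inl r) v

lemma RootedForest.graph_injective (m n : ℕ) :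
    Function.Injective (RootedForest.graph : RootedForest m n → SimpleGraph (Vertex m n)) := by
  rintro ⟨G, _, _⟩ ⟨H, _, _⟩ h
  cases h
  rfl

noncomputable instance (m n : ℕ) : Fintype (RootedForest m n) :=
  Fintype.ofInjective _ (RootedForest.graph_injective m n)

namespace RootedForest

variable {m n : ℕ}

/-- `p` is the parent of `u` (and `u` is a child of `p`): they are adjacent, and `p` is closer to
the root `r` of their tree than `u`. -/
def IsParent (F : RootedForest m n) (p u : Vertex m n) : Prop :=
  F.graph.Adj p u ∧ ∃ r : Fin (n - m + 1), F.graph.Reachable (Sum.inl r) u ∧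
    F.graph.dist (Sum.inl r) u = F.graph.dist (Sum.inl r) p + 1

/-- The number of children of the vertex `v`. -/
noncomputable def deg (F : RootedForest m n) (v : Vertex m n) : ℕ :=
  (Finset.univ.filter fun u => F.IsParent v u).card

/-- `deg(0)`: the total number of children of all roots. -/
noncomputable def rootDeg (F : RootedForest m n) : ℕ := ∑ r : Fin (n - m + 1), F.deg (Sum.inl r)

/-- Every non-root vertex has exactly one parent. -/
lemma existsUnique_parent (F : RootedForest m n) (i : Fin m) :
    ∃! p, F.IsParent p (Sum.inr i) := by
  obtain ⟨r, hr, hur⟩ := F.existsUnique_root (Sum.inr i)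
  have key : ∀ p, F.IsParent p (Sum.inr i) → ∃ w : F.graph.Walk (Sum.inl r) (Sum.inr i),
      w.IsPath ∧ w.penultimate = p := by
    rintro p ⟨hadj, r', hr', hd⟩
    obtain rfl : r' = r := hur r' hr'
    obtain ⟨w, hw⟩ := (hr'.trans hadj.symm.reachable).exists_walk_length_eq_dist
    refine ⟨w.concat hadj, ?_, by simp⟩
    apply SimpleGraph.Walk.isPath_of_length_eq_dist
    rw [SimpleGraph.Walk.length_concat, hw, hd]
  have hex : ∃ p, F.IsParent p (Sum.inr i) := by
    obtain ⟨w, hw⟩ := hr.exists_walk_length_eq_dist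
    have hnil : ¬ w.Nil := SimpleGraph.Walk.not_nil_of_ne (by simp)
    have hadj := w.adj_penultimate hnil
    refine ⟨w.penultimate, hadj, r, hr, ?_⟩
    have h1 : F.graph.dist (Sum.inl r) w.penultimate ≤ w.length - 1 := by
      refine (SimpleGraph.dist_le w.dropLast).trans ?_
      simp
    have h2 : 0 < w.length := by
      rcases Nat.eq_zero_or_pos w.length with h | h
      · exact absurd (SimpleGraph.Walk.length_eq_zero_iff.mp h) hnil
      · exact h
    obtain ⟨w', hw'⟩ := (hr.trans hadj.symm.reachable).exists_walk_length_eq_dist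
    have h3 := SimpleGraph.dist_le (w'.concat hadj)
    rw [SimpleGraph.Walk.length_concat] at h3
    omega
  obtain ⟨p, hp⟩ := hex
  refine ⟨p, hp, fun q hq => ?_⟩
  obtain ⟨w, hw, rfl⟩ := key p hp
  obtain ⟨w', hw', rfl⟩ := key q hq
  have := (F.acyclic.subsingleton_path _ _).elim ⟨w, hw⟩ ⟨w', hw'⟩
  rw [Subtype.mk.injEq] at this
  rw [this]

/-- The parent of the non-root vertex labelled `i + 1`. -/
noncomputable def parent (F : RootedForest m n) (i : Fin m) : Vertex m n :=
  (F.existsUnique_parent i).choose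

/-- `deg(p)`: the number of children of the parent `p` of the vertex labelled `1`. -/
noncomputable def parentDeg (hm : 1 ≤ m) (F : RootedForest m n) : ℕ := F.deg (F.parent ⟨0, hm⟩)

end RootedForest

/-- The trinomial coefficient `k! / (a! b! c!)` for `a + b + c = k`, which is `0` as soon as one of
the lower entries is negative. -/
def trinomial (k a b c : ℤ) : ℕ :=
  if 0 ≤ a ∧ 0 ≤ b ∧ 0 ≤ c ∧ a + b + c = k then
    k.toNat.factorial / (a.toNat.factorial * b.toNat.factorial * c.toNat.factorial)
  else 0

/-- The field of rational functions in two indeterminates. -/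
abbrev RatFun : Type := FractionRing (MvPolynomial (Fin 2) ℚ)

/-- The first indeterminate. -/
noncomputable def x : RatFun := algebraMap (MvPolynomial (Fin 2) ℚ) RatFun (MvPolynomial.X 0)

/-- The second indeterminate. -/
noncomputable def y : RatFun := algebraMap (MvPolynomial (Fin 2) ℚ) RatFun (MvPolynomial.X 1)

end ParkingForest

namespace ParkingForest

open scoped Classical
open Finset

/-! Forests and parking functions obey the same recursion on levels. In a forest with k roots, let S
be the set of children of roots, each labelled by its parent; deleting the roots leaves a forest
with root set S on the other vertices. In a parking function for k + #A - 1 spots, let S be the set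
of cars preferring one of the first k spots, labelled by that preference; lowering the other
preferences by k leaves a parking function with parameter #S. `LevelModel` axiomatises this.
Siblings, like cars with equal preferences, lie on the same level, so the recursion determines both
statistics, and their joint distribution depends only on k and #A (`LevelModel.sum_lev_lel`).

The sums are binomial because parameter plus size of the rest is #S + (#A - #S) = #A: the powers
contributed by the rest have a base independent of S. This gives k(k + a)^(a - 1) structures on a
points, then the distribution of `lel` by induction, then the joint one.

What remains is to match the models with the objects of the statement: a counting criterion for
parking (`isParkingFunction_iff`) and the recovery of a forest from its parent map
(`RootedForest.parentGraph_parent`). -/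

/-- A family of combinatorial structures `Obj k A` on finite sets `A`, with a parameter `k`, which
decompose into a first level `S ⊆ A`, a labelling of `S` by `Fin k`, and a structure on the
complement of `S` with parameter `#S`. -/
structure LevelModel where
  Obj : ℕ → Type → Type
  finite : ∀ k A [Fintype A], Finite (Obj k A)
  glue : ∀ {k A} [Fintype A] (S : Finset A), (S → Fin k) → Obj #S {a // a ∉ S} → Obj k A
  glue_bijective : ∀ k A [Fintype A], Function.Bijective
    fun d : (Σ S : Finset A, (S → Fin k) × Obj #S {a // a ∉ S}) => glue d.1 d.2.1 d.2.2
  card_of_isEmpty : ∀ k A [Fintype A] [IsEmpty A], Nat.card (Obj k A) = 1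
  isEmpty_zero : ∀ A [Fintype A] [Nonempty A], IsEmpty (Obj 0 A)
  /-- the size of the first level -/
  lev : ∀ {k A} [Fintype A], Obj k A → ℕ
  /-- the number of elements with the same label as a given one -/
  lel : ∀ {k A} [Fintype A], Obj k A → A → ℕ
  lev_glue : ∀ {k A} [Fintype A] (S : Finset A) (f : S → Fin k) (w : Obj #S {a // a ∉ S}),
    lev (glue S f w) = #S
  lel_glue_mem : ∀ {k A} [Fintype A] (S : Finset A) (f : S → Fin k) (w : Obj #S {a // a ∉ S})
    (a : A) (h : a ∈ S), lel (glue S f w) a = #{b : S | f b = f ⟨a, h⟩}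
  lel_glue_notMem : ∀ {k A} [Fintype A] (S : Finset A) (f : S → Fin k) (w : Obj #S {a // a ∉ S})
    (a : A) (h : a ∉ S), lel (glue S f w) a = lel w ⟨a, h⟩

/-! ### Binomial sums and labellings -/

lemma sum_choose_mul_self {R : Type*} [CommSemiring R] (u v : R) (a : ℕ) :
    ∑ s ∈ range (a + 2), ((a + 1).choose s : R) * s * u ^ s * v ^ (a + 1 - s) =
      (a + 1) * u * (u + v) ^ a := by
  rw [sum_range_succ']
  simp only [Nat.cast_zero, mul_zero, zero_mul, add_zero]
  rw [add_pow, mul_sum]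
  refine sum_congr rfl fun s hs => ?_
  have h : ((a + 1 : ℕ) : R) * (a.choose s : R) =
      ((a + 1).choose (s + 1) : R) * ((s + 1 : ℕ) : R) := by
    exact_mod_cast congrArg (Nat.cast : ℕ → R) (Nat.add_one_mul_choose_eq a s)
  rw [← h]
  rw [Nat.add_sub_add_right]
  push_cast
  ring

lemma sum_choose_mul_self_pred {R : Type*} [CommSemiring R] (u v : R) (a : ℕ) :
    ∑ s ∈ range (a + 1), (a.choose s : R) * s * u ^ s * v ^ (a - s) =
      a * u * (u + v) ^ (a - 1) := by
  cases a with
  | zero => simp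
  | succ a => rw [sum_choose_mul_self]; push_cast; simp

/-- Labellings by the number of points which have the same label as a given point. -/
lemma sum_pow_card_fiber {R : Type*} [CommRing R] {B : Type*} [Fintype B] (b₀ : B) (k : ℕ) (y : R) :
    ∑ f : B → Fin k, y ^ #{b : B | f b = f b₀} =
      k * y * (y + k - 1) ^ (Fintype.card B - 1) := by
  -- Conditioning on the common label c of the fibre makes the weight a product over points; the
  -- factor at `b₀` forces `f b₀ = c`.
  have h1 : ∀ f : B → Fin k, y ^ #{b : B | f b = f b₀} =
      ∑ c : Fin k, ∏ b : B, if b = b₀ then (if f b = c then y else 0) else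
        (if f b = c then y else 1) := by
    intro f
    rw [sum_eq_single (f b₀)]
    · rw [← prod_const, prod_filter]
      refine prod_congr rfl fun b _ => ?_
      by_cases hb : b = b₀ <;> simp [hb]
    · intro c _ hc
      exact prod_eq_zero (mem_univ b₀) (by simp [hc.symm])
    · simp
  have h2 : ∀ c : Fin k, ∑ d : Fin k, (if d = c then y else 1) = y + k - 1 := by
    intro c
    rw [← add_sum_erase _ _ (mem_univ c), sum_congr rfl (g := fun _ => (1 : R))]
    · rw [sum_const, card_erase_of_mem (mem_univ c), card_univ, Fintype.card_fin, nsmul_eq_mul,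
        Nat.cast_sub (by have := c.2; omega)]
      simp
      ring
    · intro d hd
      simp [ne_of_mem_erase hd]
  simp_rw [h1]
  rw [sum_comm]
  have h3 : ∀ c : Fin k, ∑ f : B → Fin k, ∏ b : B, (if b = b₀ then (if f b = c then y else 0) else
        (if f b = c then y else 1)) = y * (y + k - 1) ^ (Fintype.card B - 1) := by
    intro c
    have := Fintype.prod_sum (fun (b : B) (d : Fin k) =>
      if b = b₀ then (if d = c then y else 0) else (if d = c then y else 1))
    rw [← this, ← mul_prod_erase _ _ (mem_univ b₀)]
    congr 1
    · simp
    · rw [prod_congr rfl (g := fun _ => y + k - 1), prod_const, card_erase_of_mem (mem_univ _),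
        card_univ]
      intro b hb
      simp only [ne_of_mem_erase hb, if_false]
      exact h2 c
  rw [sum_congr rfl fun c _ => h3 c]
  simp [mul_assoc]

/-! ### Enumeration in a level model -/

namespace LevelModel

variable (M : LevelModel)

noncomputable instance (k : ℕ) (A : Type) [Fintype A] : Fintype (M.Obj k A) :=
  have := M.finite k A
  Fintype.ofFinite _

lemma sum_glue {R : Type*} [AddCommMonoid R] (k : ℕ) (A : Type) [Fintype A] (F : M.Obj k A → R) :
    ∑ π, F π = ∑ S : Finset A, ∑ f : S → Fin k, ∑ w : M.Obj #S {a // a ∉ S}, F (M.glue S f w) := by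
  rw [← (M.glue_bijective k A).sum_comp, Fintype.sum_sigma]
  refine sum_congr rfl fun S _ => ?_
  rw [Fintype.sum_prod_type]

lemma card_compl {A : Type} [Fintype A] (S : Finset A) :
    Fintype.card {a // a ∉ S} = Fintype.card A - #S := by
  rw [Fintype.card_subtype_compl]
  simp

lemma card_eq_sum (k : ℕ) (A : Type) [Fintype A] :
    Fintype.card (M.Obj k A) =
      ∑ S : Finset A, k ^ #S * Fintype.card (M.Obj #S {a // a ∉ S}) := by
  rw [Fintype.card_eq_sum_ones, M.sum_glue]
  simp

/-- The factor k + a avoids the exponent a - 1. In the induction every complement contributes powers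
of the same base a + 1, so the sum over S is a derivative of the binomial theorem. -/
theorem mul_card (a : ℕ) : ∀ (k : ℕ) (A : Type) [Fintype A], Fintype.card A = a →
    (k + a) * Fintype.card (M.Obj k A) = k * (k + a) ^ a := by
  induction a using Nat.strong_induction_on with
  | _ a ih =>
    intro k A _ hA
    rcases a with _ | a
    · have := Fintype.card_eq_zero_iff.mp hA
      rw [← Nat.card_eq_fintype_card, M.card_of_isEmpty]
      simp
    · have : Nonempty A := Fintype.card_pos_iff.mp (by omega)
      have hS : ∀ S : Finset A, (a + 1) * (k ^ #S * Fintype.card (M.Obj #S {a // a ∉ S})) =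
          k ^ #S * (#S * (a + 1) ^ (a + 1 - #S)) := by
        intro S
        have hle : #S ≤ a + 1 := hA ▸ card_le_univ S
        rcases S.eq_empty_or_nonempty with rfl | hne
        · have : Nonempty {a : A // a ∉ (∅ : Finset A)} := ⟨⟨Classical.arbitrary A, by simp⟩⟩
          have : IsEmpty (M.Obj #(∅ : Finset A) {a : A // a ∉ (∅ : Finset A)}) := M.isEmpty_zero _
          rw [Fintype.card_eq_zero]
          simp
        · have hpos := hne.card_pos
          have := ih (a + 1 - #S) (by omega) #S {a // a ∉ S} (by rw [card_compl, hA])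
          rw [Nat.add_sub_cancel' hle] at this
          rw [← this]
          ring
      have key : (a + 1) * Fintype.card (M.Obj k A) = (a + 1) * (k * (k + (a + 1)) ^ a) := by
        rw [card_eq_sum, mul_sum, sum_congr rfl fun S _ => hS S, ← powerset_univ,
          sum_powerset_apply_card (fun s => k ^ s * (s * (a + 1) ^ (a + 1 - s))), card_univ, hA]
        have := sum_choose_mul_self k (a + 1) a
        simp only [Nat.cast_id, smul_eq_mul] at this ⊢
        rw [← mul_assoc, ← this]
        exact sum_congr rfl fun s _ => by ring
      have := Nat.eq_of_mul_eq_mul_left (by omega) key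
      rw [this]
      ring

/-- The number of structures on `a` points with parameter `k`. -/
def count (k a : ℕ) : ℕ := if a = 0 then 1 else k * (k + a) ^ (a - 1)

lemma mul_count (k a : ℕ) : (k + a) * count k a = k * (k + a) ^ a := by
  unfold count
  rcases a with _ | a
  · simp
  · simp; ring

lemma card_eq_count (k : ℕ) (A : Type) [Fintype A] :
    Fintype.card (M.Obj k A) = count k (Fintype.card A) := by
  rcases Nat.eq_zero_or_pos (Fintype.card A) with h | h
  · have := Fintype.card_eq_zero_iff.mp h
    rw [← Nat.card_eq_fintype_card, M.card_of_isEmpty]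
    simp [count]
  · have h1 := M.mul_card _ k A rfl
    rw [← mul_count] at h1
    exact Nat.eq_of_mul_eq_mul_left (by omega) h1

/-- The joint distribution of `lev` and `lel`, under an assumption on the distribution of `lel` on
smaller sets. -/
lemma sum_of_sum_compl {R : Type*} [CommRing R] (k a : ℕ) (A : Type) [Fintype A]
    (hA : Fintype.card A = a + 1) (a₀ : A)
    (y : R) (g : ℕ → R)
    (H : ∀ (S : Finset A) (h : a₀ ∉ S), ∑ w : M.Obj #S {a // a ∉ S}, y ^ M.lel w ⟨a₀, h⟩ =
      #S * y * (y + a) ^ (a - #S)) :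
    ∑ π : M.Obj k A, g (M.lev π) * y ^ M.lel π a₀ =
      ∑ s ∈ range (a + 1), (a.choose s : R) * (g s * k ^ s * (s * y * (y + a) ^ (a - s))) +
      ∑ s ∈ range (a + 1), (a.choose s : R) *
        (g (s + 1) * (k * y * (y + k - 1) ^ s) * count (s + 1) (a - s)) := by
  have hcard : #((univ : Finset A).erase a₀) = a := by
    rw [card_erase_of_mem (mem_univ _), card_univ, hA, Nat.add_sub_cancel]
  -- The first levels avoiding `a₀` are the subsets of its complement; the others arise from these
  -- by inserting `a₀`.
  rw [M.sum_glue, ← powerset_univ, ← insert_erase (mem_univ a₀),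
    sum_powerset_insert (notMem_erase _ _)]
  congr 1
  · have : ∀ S ∈ ((univ : Finset A).erase a₀).powerset,
        ∑ f : S → Fin k, ∑ w : M.Obj #S {a // a ∉ S},
          g (M.lev (M.glue S f w)) * y ^ M.lel (M.glue S f w) a₀ =
        g #S * k ^ #S * (#S * y * (y + a) ^ (a - #S)) := by
      intro S hS
      have h : a₀ ∉ S := fun h => notMem_erase a₀ univ (mem_powerset.mp hS h)
      simp_rw [M.lev_glue, M.lel_glue_notMem S _ _ a₀ h, ← mul_sum, H S h]
      simp
      ring
    rw [sum_congr rfl this,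
      sum_powerset_apply_card (fun s => g s * (k : R) ^ s * (s * y * (y + a) ^ (a - s))), hcard]
    simp [nsmul_eq_mul]
  · have : ∀ S ∈ ((univ : Finset A).erase a₀).powerset,
        ∑ f : ↥(insert a₀ S) → Fin k, ∑ w : M.Obj #(insert a₀ S) {a // a ∉ insert a₀ S},
          g (M.lev (M.glue (insert a₀ S) f w)) * y ^ M.lel (M.glue (insert a₀ S) f w) a₀ =
        g (#S + 1) * (k * y * (y + k - 1) ^ #S) * count (#S + 1) (a - #S) := by
      intro S hS
      have h : a₀ ∉ S := fun h => notMem_erase a₀ univ (mem_powerset.mp hS h)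
      have hc : #(insert a₀ S) = #S + 1 := card_insert_of_notMem h
      simp_rw [M.lev_glue, M.lel_glue_mem _ _ _ a₀ (mem_insert_self a₀ S)]
      simp only [sum_const, card_univ, nsmul_eq_mul]
      have hf : ∑ f : ↥(insert a₀ S) → Fin k,
          y ^ #{b | f b = f ⟨a₀, mem_insert_self a₀ S⟩} = k * y * (y + k - 1) ^ #S := by
        convert sum_pow_card_fiber (B := ↥(insert a₀ S)) ⟨a₀, mem_insert_self a₀ S⟩ k y
        rw [Fintype.card_coe, hc, Nat.add_sub_cancel]
      rw [← mul_sum, ← mul_sum, hf, M.card_eq_count, card_compl, hA, hc, Nat.add_sub_add_right]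
      ring
    rw [sum_congr rfl this, sum_powerset_apply_card
      (fun s => g (s + 1) * ((k : R) * y * (y + k - 1) ^ s) * count (s + 1) (a - s)), hcard]
    simp [nsmul_eq_mul]

/-- Contribution of the structures with the marked point beyond the first level. The truncated
exponent is harmless: at a = 0 the factor a vanishes. -/
lemma sum_first {R : Type*} [CommRing R] (k a : ℕ) (x y : R) :
    ∑ s ∈ range (a + 1), (a.choose s : R) * (x ^ s * k ^ s * (s * y * (y + a) ^ (a - s))) =
      k * x * y * (a * (k * x + y + a) ^ (a - 1)) := by
  have := sum_choose_mul_self_pred (k * x) (y + a) a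
  rw [show k * x * y * (a * (k * x + y + a) ^ (a - 1)) =
    y * (a * (k * x) * (k * x + (y + a)) ^ (a - 1)) by ring, ← this, mul_sum]
  exact sum_congr rfl fun s _ => by ring

/-- Contribution of the structures with the marked point on the first level; s counts the other
points of that level. The factor a + 2 = (s + 1) + (a + 1 - s) turns `count` into an honest power,
and splitting s + 1 leaves one plain and one s-weighted binomial sum. -/
lemma sum_second {R : Type*} [CommRing R] [IsDomain R] [CharZero R] (k a : ℕ) (x y : R) :
    ∑ s ∈ range (a + 2), ((a + 1).choose s : R) *
        (x ^ (s + 1) * (k * y * (y + k - 1) ^ s) * count (s + 1) (a + 1 - s)) =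
      k * x * y * ((x * y + (k - 1) * x + 1) * (x * y + (k - 1) * x + (a + 2)) ^ a) := by
  have ha : ((a : R) + 2) ≠ 0 := by exact_mod_cast Nat.succ_ne_zero (a + 1)
  apply mul_left_cancel₀ ha
  have h1 : ((a : R) + 2) * ∑ s ∈ range (a + 2), ((a + 1).choose s : R) *
        (x ^ (s + 1) * (k * y * (y + k - 1) ^ s) * count (s + 1) (a + 1 - s)) =
      k * x * y * ((x * (y + k - 1) + (a + 2)) ^ (a + 1) +
        (a + 1) * (x * (y + k - 1)) * (x * (y + k - 1) + (a + 2)) ^ a) := by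
    rw [← sum_choose_mul_self, add_pow, ← sum_add_distrib, mul_sum, mul_sum]
    refine sum_congr rfl fun s hs => ?_
    have hs' : s ≤ a + 1 := by have := mem_range.mp hs; omega
    have h := congrArg (Nat.cast : ℕ → R) (mul_count (s + 1) (a + 1 - s))
    rw [show s + 1 + (a + 1 - s) = a + 2 by omega] at h
    push_cast at h
    calc _ = ((a + 1).choose s : R) * (x ^ (s + 1) * (k * y * (y + k - 1) ^ s)) *
          (((a : R) + 2) * count (s + 1) (a + 1 - s)) := by ring
      _ = _ := by rw [h, mul_pow]; ring
  rw [h1]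
  ring

/-- An empty S gives nothing, since no structure with parameter 0 exists on a nonempty set;
otherwise the complement is smaller, and its base is y + #S + (a - #S) = y + a. -/
lemma sum_pow_lel_compl {R : Type*} [CommRing R] (a : ℕ)
    (ih : ∀ b < a, ∀ (k : ℕ) (A : Type) [Fintype A], Fintype.card A = b + 1 → ∀ (a₀ : A) (y : R),
      ∑ π : M.Obj k A, y ^ M.lel π a₀ = k * y * (y + k + b) ^ b)
    {A : Type} [Fintype A] (hA : Fintype.card A = a + 1) (a₀ : A) (y : R) (S : Finset A)
    (h : a₀ ∉ S) :
    ∑ w : M.Obj #S {a // a ∉ S}, y ^ M.lel w ⟨a₀, h⟩ = #S * y * (y + a) ^ (a - #S) := by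
  have hlt : #S < a + 1 := by
    rw [← hA, ← card_univ]
    exact card_lt_card (ssubset_univ_iff.mpr fun h' => h (h' ▸ mem_univ a₀))
  rcases S.eq_empty_or_nonempty with rfl | hne
  · have : Nonempty {a : A // a ∉ (∅ : Finset A)} := ⟨⟨a₀, by simp⟩⟩
    have : IsEmpty (M.Obj #(∅ : Finset A) {a : A // a ∉ (∅ : Finset A)}) := M.isEmpty_zero _
    rw [sum_eq_zero fun w _ => isEmptyElim w]
    simp
  · have hpos := hne.card_pos
    rw [ih (a - #S) (by omega) #S {a // a ∉ S} (by rw [card_compl, hA]; omega) ⟨a₀, h⟩ y,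
      Nat.cast_sub (by omega)]
    congr 2
    ring

/-- Forgetting `lev` closes the induction: at x = 1 the two contributions have the same base and add
up to a single power. -/
theorem sum_pow_lel {R : Type*} [CommRing R] [IsDomain R] [CharZero R] (a : ℕ) :
    ∀ (k : ℕ) (A : Type) [Fintype A], Fintype.card A = a + 1 → ∀ (a₀ : A) (y : R),
      ∑ π : M.Obj k A, y ^ M.lel π a₀ = k * y * (y + k + a) ^ a := by
  induction a using Nat.strong_induction_on with
  | _ a ih =>
    intro k A _ hA a₀ y
    have h := M.sum_of_sum_compl k a A hA a₀ y (fun _ => (1 : R))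
      (M.sum_pow_lel_compl a ih hA a₀ y)
    have h1 := sum_first k a (1 : R) y
    simp only [one_mul, one_pow, mul_one] at h h1
    rw [h, h1]
    rcases a with _ | a
    · simp [count]
    · have h2 := sum_second k a (1 : R) y
      simp only [one_mul, one_pow, mul_one] at h2
      rw [h2]
      simp only [Nat.add_sub_cancel]
      push_cast
      ring

/-- The joint distribution of `lev` and `lel`. -/
theorem sum_lev_lel {R : Type*} [CommRing R] [IsDomain R] [CharZero R] (k a : ℕ) (A : Type)
    [Fintype A] (hA : Fintype.card A = a + 1) (a₀ : A) (y : R) (g : ℕ → R) :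
    ∑ π : M.Obj k A, g (M.lev π) * y ^ M.lel π a₀ =
      ∑ s ∈ range (a + 1), (a.choose s : R) * (g s * k ^ s * (s * y * (y + a) ^ (a - s))) +
      ∑ s ∈ range (a + 1), (a.choose s : R) *
        (g (s + 1) * (k * y * (y + k - 1) ^ s) * count (s + 1) (a - s)) :=
  M.sum_of_sum_compl k a A hA a₀ y g
    (M.sum_pow_lel_compl a (fun b _ => M.sum_pow_lel b) hA a₀ y)

end LevelModel
/-- The fibre of a function which is assembled from its restrictions to a set, through a point of
the set. -/
lemma card_fiber_mem {A C D : Type*} [Fintype A] [DecidableEq C] [DecidableEq D]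
    (S : Finset A) (q : A → C) (f : S → D)
    (hf : ∀ a b : S, q a = q b ↔ f a = f b) (hS : ∀ a b, q a = q b → a ∈ S → b ∈ S)
    (a : A) (ha : a ∈ S) : #{b | q b = q a} = #{b : S | f b = f ⟨a, ha⟩} := by
  rw [← card_map (Function.Embedding.subtype (· ∈ S))]
  congr 1
  ext b
  simp only [mem_filter, mem_univ, true_and, mem_map, Function.Embedding.subtype_apply,
    Subtype.exists, exists_and_right, exists_eq_right]
  constructor
  · intro h
    have hb := hS a b h.symm ha
    exact ⟨hb, (hf ⟨b, hb⟩ ⟨a, ha⟩).1 h⟩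
  · rintro ⟨hb, h⟩
    exact (hf ⟨b, hb⟩ ⟨a, ha⟩).2 h

/-- The fibre of a function which is assembled from its restrictions to a set and its complement,
through a point of the complement. -/
lemma card_fiber_notMem {A C D : Type*} [Fintype A] [DecidableEq C] [DecidableEq D]
    (S : Finset A) (q : A → C)
    (f : {a // a ∉ S} → D) (hf : ∀ a b : {a // a ∉ S}, q a = q b ↔ f a = f b)
    (hS : ∀ a b, q a = q b → a ∈ S → b ∈ S) (a : A) (ha : a ∉ S) :
    #{b | q b = q a} = #{b : {a // a ∉ S} | f b = f ⟨a, ha⟩} := by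
  rw [← card_map (Function.Embedding.subtype (· ∉ S))]
  congr 1
  ext b
  simp only [mem_filter, mem_univ, true_and, mem_map, Function.Embedding.subtype_apply,
    Subtype.exists, exists_and_right, exists_eq_right]
  constructor
  · intro h
    have hb : b ∉ S := fun hb => ha (hS b a h hb)
    exact ⟨hb, (hf ⟨b, hb⟩ ⟨a, ha⟩).1 h⟩
  · rintro ⟨hb, h⟩
    exact (hf ⟨b, hb⟩ ⟨a, ha⟩).2 h

/-! ### Parking functions as a level model -/

/-- The counting condition which characterises parking functions for `k + #A - 1` spots, the spots
being numbered from `0`. -/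
def IsPark (k : ℕ) {A : Type} (π : A → ℕ) : Prop :=
  ∀ j ≤ Nat.card A, j ≤ Nat.card {i // π i + 1 < k + j}

/-- The condition at j = #A concerns all cars, so preferences in ℕ are automatically bounded. -/
lemma IsPark.lt {k : ℕ} {A : Type} [Fintype A] {π : A → ℕ} (h : IsPark k π) (a : A) :
    π a + 1 < k + Fintype.card A := by
  by_contra hlt
  have h1 := h (Nat.card A) le_rfl
  rw [Nat.card_eq_fintype_card, Nat.card_eq_fintype_card] at h1
  exact absurd (Fintype.card_subtype_lt (p := fun i => π i + 1 < k + Fintype.card A) hlt)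
    (not_lt.2 h1)

/-- Glue labels in `{0, …, k - 1}` on `S` with labels `≥ k` outside of `S`. -/
noncomputable def parkGlue {k : ℕ} {A : Type} (S : Finset A) (f : S → Fin k)
    (w : {a // a ∉ S} → ℕ) (a : A) : ℕ :=
  if h : a ∈ S then f ⟨a, h⟩ else w ⟨a, h⟩ + k

section

variable {k : ℕ} {A : Type} (S : Finset A) (f : S → Fin k) (w : {a // a ∉ S} → ℕ)

lemma parkGlue_mem (a : A) (h : a ∈ S) : parkGlue S f w a = f ⟨a, h⟩ := by simp [parkGlue, h]

lemma parkGlue_notMem (a : A) (h : a ∉ S) : parkGlue S f w a = w ⟨a, h⟩ + k := by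
  simp [parkGlue, h]

lemma parkGlue_lt_iff (a : A) : parkGlue S f w a < k ↔ a ∈ S := by
  by_cases h : a ∈ S
  · simp [parkGlue_mem S f w a h, h]
  · simp [parkGlue_notMem S f w a h, h]

lemma card_parkGlue [Fintype A] (j : ℕ) :
    Nat.card {i // parkGlue S f w i + 1 < k + (j + 1)} =
      #S + Nat.card {i // w i + 1 < j + 1} := by
  rw [Nat.card_eq_fintype_card, Nat.card_eq_fintype_card, Fintype.card_subtype,
    Fintype.card_subtype, ← card_map (Function.Embedding.subtype (· ∉ S)), ← card_union_of_disjoint]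
  · congr 1
    ext a
    simp only [mem_filter, mem_univ, true_and, mem_union, mem_map,
      Function.Embedding.subtype_apply, Subtype.exists, exists_and_right, exists_eq_right]
    by_cases h : a ∈ S
    · have := (f ⟨a, h⟩).2
      simp only [parkGlue_mem S f w a h, h, true_or, iff_true]
      omega
    · simp only [parkGlue_notMem S f w a h, h, not_false_eq_true, exists_true_left, false_or]
      omega
  · rw [disjoint_left]
    intro a ha h
    simp only [mem_map, Function.Embedding.subtype_apply, Subtype.exists, exists_and_right,
      exists_eq_right] at h
    exact h.1 ha

/-- For j ≤ #S the condition is automatic, as all labels on S are below k; for larger j it is the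
condition on the rest at j - #S. -/
lemma isPark_parkGlue [Fintype A] : IsPark k (parkGlue S f w) ↔ IsPark #S w := by
  have hc : Nat.card {a // a ∉ S} = Nat.card A - #S := by
    rw [Nat.card_eq_fintype_card, Nat.card_eq_fintype_card, LevelModel.card_compl]
  have hle : #S ≤ Nat.card A := by rw [Nat.card_eq_fintype_card]; exact card_le_univ S
  unfold IsPark
  rw [hc]
  constructor
  · intro H j hj
    rcases j with _ | j
    · simp
    · have := H (#S + j + 1) (by omega)
      rw [card_parkGlue] at this
      rw [← add_assoc]
      omega
  · intro H j hj
    rcases j with _ | j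
    · simp
    · rw [card_parkGlue]
      by_cases h : j + 1 ≤ #S
      · omega
      · have := H (j + 1 - #S) (by omega)
        rw [Nat.add_sub_cancel' (by omega)] at this
        omega

end

/-- Parking functions form a level model. -/
noncomputable def parkModel : LevelModel where
  Obj k A := {π : A → ℕ // IsPark k π}
  finite k A _ := by
    refine Finite.of_injective (β := A → Fin (k + Fintype.card A))
      (fun π a => ⟨π.1 a, by have := π.2.lt a; omega⟩) fun π ρ h => Subtype.ext (funext fun a => ?_)
    simpa using congrFun h a
  glue S f w := ⟨parkGlue S f w.1, (isPark_parkGlue S f w.1).2 w.2⟩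
  glue_bijective k A _ := by
    constructor
    · rintro ⟨S, f, w⟩ ⟨T, g, v⟩ h
      have h' : parkGlue S f w.1 = parkGlue T g v.1 := congrArg Subtype.val h
      obtain rfl : S = T := by
        ext a
        rw [← parkGlue_lt_iff S f w.1, h', parkGlue_lt_iff]
      have hf : f = g := funext fun a => Fin.ext (by
        rw [← parkGlue_mem S f w.1 a a.2, h', parkGlue_mem S g v.1 a a.2])
      have hw : w = v := Subtype.ext (funext fun a => by
        have := congrFun h' a.1
        rw [parkGlue_notMem S f w.1 a a.2, parkGlue_notMem S g v.1 a a.2] at this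
        exact Nat.add_right_cancel this)
      rw [hf, hw]
    · rintro ⟨π, hπ⟩
      let S : Finset A := {a | π a < k}
      let f : S → Fin k := fun a => ⟨π a, (mem_filter.1 a.2).2⟩
      let w : {a // a ∉ S} → ℕ := fun a => π a - k
      have h : parkGlue S f w = π := by
        funext a
        by_cases ha : a ∈ S
        · rw [parkGlue_mem S f w a ha]
        · rw [parkGlue_notMem S f w a ha]
          have : k ≤ π a := by simpa [S] using ha
          simp only [w]
          omega
      exact ⟨⟨S, f, w, (isPark_parkGlue S f w).1 (h ▸ hπ)⟩, Subtype.ext h⟩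
  card_of_isEmpty k A _ _ := by
    rw [Nat.card_eq_one_iff_unique]
    refine ⟨⟨fun π ρ => Subtype.ext (Subsingleton.elim _ _)⟩, ⟨⟨isEmptyElim, ?_⟩⟩⟩
    intro j hj
    simp at hj
    simp [hj]
  isEmpty_zero A _ _ := ⟨fun π => by
    -- For k = 0 and j = 1 some car would satisfy π i + 1 < 1.
    have := π.2 1 (Nat.card_pos)
    simp at this⟩
  lev {k A} _ π := #{a | π.1 a < k}
  lel π a := #{b | π.1 b = π.1 a}
  lev_glue S f w := by simp [parkGlue_lt_iff]
  lel_glue_mem S f w a h := by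
    refine card_fiber_mem S (parkGlue S f w.1) f ?_ ?_ a h
    · intro a b
      rw [parkGlue_mem _ _ _ _ a.2, parkGlue_mem _ _ _ _ b.2, Fin.val_inj]
    · intro a b h ha
      rwa [← parkGlue_lt_iff S f w.1, ← h, parkGlue_lt_iff]
  lel_glue_notMem S f w a h := by
    refine card_fiber_notMem S (parkGlue S f w.1) w.1 ?_ ?_ a h
    · intro a b
      rw [parkGlue_notMem _ _ _ _ a.2, parkGlue_notMem _ _ _ _ b.2, add_left_inj]
    · intro a b h ha
      rwa [← parkGlue_lt_iff S f w.1, ← h, parkGlue_lt_iff]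

/-- The parking process, made total by the default value `π i` when no spot is free, so that σ is
available before it is known that every car parks. -/
lemma exists_greedy {m n : ℕ} (π : Fin m → Fin n) :
    ∃ σ : Fin m → Fin n, ∀ i, {j : Fin n | π i ≤ j ∧ ∀ k < i, σ k ≠ j}.Nonempty →
      IsLeast {j : Fin n | π i ≤ j ∧ ∀ k < i, σ k ≠ j} (σ i) := by
  let F : ∀ i : Fin m, (∀ k, k < i → Fin n) → Fin n := fun i τ =>
    if h : {j : Fin n | π i ≤ j ∧ ∀ k (hk : k < i), τ k hk ≠ j}.Nonempty then
      wellFounded_lt.min _ h else π i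
  refine ⟨wellFounded_lt.fix F, fun i h => ?_⟩
  rw [WellFounded.fix_eq]
  simp only [F]
  rw [dif_pos h]
  exact ⟨WellFounded.min_mem _ _ h, fun j hj => not_lt.1 (WellFounded.not_lt_min _ _ hj)⟩

/-- Necessity: cars preferring spots from q on park injectively in those n - q spots. Sufficiency:
if car i fails, take the longest final block of spots, starting at q, taken by earlier cars. The
spot before it, if any, is still free, so all cars in the block prefer spots from q on; with car i
they are n - q + 1 many. -/
lemma isParkingFunction_iff {m n : ℕ} (π : Fin m → Fin n) :
    IsParkingFunction π ↔ ∀ q ≤ n, #{i | q ≤ (π i : ℕ)} ≤ n - q := by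
  have hcard : ∀ q ≤ n, #{j : Fin n | q ≤ (j : ℕ)} = n - q := by
    intro q hq
    have := Fin.card_filter_val_lt (m := q) (n := n)
    have h2 := card_filter_add_card_filter_not (s := (univ : Finset (Fin n))) fun j => (j : ℕ) < q
    simp only [not_lt, card_univ, Fintype.card_fin] at h2
    omega
  constructor
  · rintro ⟨σ, hσ⟩ q hq
    have hinj : Function.Injective σ := by
      intro a b hab
      rcases lt_trichotomy a b with h | h | h
      · exact absurd hab ((hσ b).1.2 a h)
      · exact h
      · exact absurd hab.symm ((hσ a).1.2 b h)
    rw [← hcard q hq]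
    refine card_le_card_of_injOn σ ?_ hinj.injOn
    intro i hi
    simp only [coe_filter, mem_univ, true_and, Set.mem_ofPred_eq] at hi ⊢
    exact hi.trans (hσ i).1.1
  · intro H
    obtain ⟨σ, hσ⟩ := exists_greedy π
    have hne : ∀ i, {j : Fin n | π i ≤ j ∧ ∀ k < i, σ k ≠ j}.Nonempty := by
      intro i
      induction i using WellFoundedLT.induction with
      | ind i ih =>
      by_contra hemp
      have hex : ∃ q : ℕ, ∀ j : Fin n, q ≤ (j : ℕ) → ∃ k < i, σ k = j := by
        refine ⟨π i, fun j hj => ?_⟩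
        by_contra hk
        push Not at hk
        exact hemp ⟨j, hj, hk⟩
      obtain ⟨q, hq, hmin⟩ : ∃ q : ℕ, (∀ j : Fin n, q ≤ (j : ℕ) → ∃ k < i, σ k = j) ∧
          ∀ q' < q, ¬ ∀ j : Fin n, q' ≤ (j : ℕ) → ∃ k < i, σ k = j :=
        ⟨Nat.find hex, Nat.find_spec hex, fun q' h => Nat.find_min hex h⟩
      have hqi : q ≤ π i := by
        by_contra hlt
        refine hmin _ (not_le.1 hlt) fun j hj => ?_
        by_contra hk
        push Not at hk
        exact hemp ⟨j, hj, hk⟩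
      have hqn : q ≤ n := hqi.trans (π i).2.le
      have : Nonempty (Fin m) := ⟨i⟩
      choose! c hc hcσ using hq
      have hcq : ∀ j : Fin n, q ≤ (j : ℕ) → q ≤ (π (c j) : ℕ) := by
        intro j hj
        by_contra hlt
        have h0 := hmin (q - 1) (by omega)
        push Not at h0
        obtain ⟨j0, hj0, hfree⟩ := h0
        have hj0q : (j0 : ℕ) < q := by
          by_contra h'
          exact hfree _ (hc j0 (not_lt.1 h')) (hcσ j0 (not_lt.1 h'))
        -- Here `j0` is spot q - 1: a car preferring a spot before q would not have driven past it.
        have : σ (c j) ≤ j0 := (hσ (c j) (ih _ (hc j hj))).2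
          ⟨Fin.le_def.2 (by omega), fun k hk => hfree k (hk.trans (hc j hj))⟩
        rw [hcσ j hj, Fin.le_def] at this
        omega
      have h1 : #(insert i (({j : Fin n | q ≤ (j : ℕ)} : Finset (Fin n)).image c)) ≤ n - q := by
        refine (card_le_card ?_).trans (H q hqn)
        intro a ha
        simp only [mem_insert, mem_image, mem_filter, mem_univ, true_and] at ha ⊢
        rcases ha with rfl | ⟨j, hj, rfl⟩
        · exact hqi
        · exact hcq j hj
      rw [card_insert_of_notMem, card_image_of_injOn, hcard q hqn] at h1
      · omega
      · intro j hj j' hj' h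
        simp only [coe_filter, mem_univ, true_and, Set.mem_ofPred_eq] at hj hj'
        rw [← hcσ j hj, ← hcσ j' hj', h]
      · simp only [mem_image, mem_filter, mem_univ, true_and, not_exists, not_and]
        exact fun j hj h => (hc j hj).ne h
    exact ⟨σ, fun i => hσ i (hne i)⟩

/-- The two criteria count complementary sets of cars, with q = n - m + j; for q ≤ n - m the bound
holds trivially as m ≤ n - q. -/
lemma isParkingFunction_iff_isPark {m n : ℕ} (hmn : m ≤ n) (π : Fin m → Fin n) :
    IsParkingFunction π ↔ IsPark (n - m + 1) fun i => (π i : ℕ) := by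
  have hsum : ∀ q : ℕ, Nat.card {i // (π i : ℕ) < q} + #{i | q ≤ (π i : ℕ)} = m := by
    intro q
    rw [Nat.card_eq_fintype_card, Fintype.card_subtype]
    have := card_filter_add_card_filter_not (s := (univ : Finset (Fin m))) fun i => (π i : ℕ) < q
    simpa using this
  rw [isParkingFunction_iff, IsPark, Nat.card_fin]
  constructor
  · intro H j hj
    have h1 := H (n - m + j) (by omega)
    have h2 := hsum (n - m + j)
    have h3 : ∀ i, (π i : ℕ) + 1 < n - m + 1 + j ↔ (π i : ℕ) < n - m + j := fun i => by omega
    simp_rw [h3]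
    omega
  · intro H q hq
    have h2 := hsum q
    by_cases hqm : q ≤ n - m
    · omega
    · have h1 := H (q - (n - m)) (by omega)
      have h3 : ∀ i, (π i : ℕ) + 1 < n - m + 1 + (q - (n - m)) ↔ (π i : ℕ) < q :=
        fun i => by omega
      simp_rw [h3] at h1
      omega

/-- Sums over parking functions as sums over the level model. -/
lemma sum_PF {m n : ℕ} (hm : 1 ≤ m) (hmn : m ≤ n) {R : Type*} [AddCommMonoid R] (g : ℕ → ℕ → R) :
    ∑ π : PF m n, g (slev π) (lel hm π) =
      ∑ π : parkModel.Obj (n - m + 1) (Fin m), g (parkModel.lev π) (parkModel.lel π ⟨0, hm⟩) := by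
  let e : PF m n → parkModel.Obj (n - m + 1) (Fin m) := fun π =>
    ⟨fun i => π.1 i, (isParkingFunction_iff_isPark hmn π.1).1 π.2⟩
  refine Fintype.sum_bijective e ⟨?_, ?_⟩ _ _ ?_
  · intro π ρ h
    have h' := congrArg Subtype.val h
    exact Subtype.ext (funext fun i => Fin.ext (congrFun h' i))
  · rintro ⟨π, hπ⟩
    have hlt : ∀ i, π i < n := fun i => by
      have := hπ.lt i
      rw [Fintype.card_fin] at this
      omega
    exact ⟨⟨fun i => ⟨π i, hlt i⟩, (isParkingFunction_iff_isPark hmn _).2 hπ⟩, rfl⟩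
  · intro π
    simp [slev, lel, parkModel, Fin.ext_iff, e]

/-! ### Parent maps as a level model -/

/-- `p` is the parent map of a rooted forest with roots `C` and non-root vertices `A`. -/
def IsForestMap {C A : Type} (p : A → C ⊕ A) : Prop :=
  ∃ h : A → ℕ, ∀ a b, p a = Sum.inr b → h b < h a

/-- The vertex of `A` which is described by an element of the first level or of the rest. -/
noncomputable def levelVertex {A : Type} (S : Finset A) : Fin #S ⊕ {a // a ∉ S} → A :=
  Sum.elim (fun c => S.equivFin.symm c) Subtype.val

lemma levelVertex_injective {A : Type} (S : Finset A) : Function.Injective (levelVertex S) := by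
  refine (Subtype.val_injective.comp S.equivFin.symm.injective).sumElim Subtype.val_injective ?_
  intro c a h
  exact a.2 (h ▸ (S.equivFin.symm c).2)

lemma levelVertex_surjective {A : Type} (S : Finset A) : Function.Surjective (levelVertex S) := by
  intro a
  by_cases h : a ∈ S
  · exact ⟨Sum.inl (S.equivFin ⟨a, h⟩), by simp [levelVertex]⟩
  · exact ⟨Sum.inr ⟨a, h⟩, rfl⟩

/-- The forest with first level `S` which is described by `w` on the other levels. -/
noncomputable def forestGlue {k : ℕ} {A : Type} (S : Finset A) (f : S → Fin k)
    (w : {a // a ∉ S} → Fin #S ⊕ {a // a ∉ S}) (a : A) : Fin k ⊕ A :=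
  if h : a ∈ S then Sum.inl (f ⟨a, h⟩) else Sum.inr (levelVertex S (w ⟨a, h⟩))

section

variable {k : ℕ} {A : Type} (S : Finset A) (f : S → Fin k)
  (w : {a // a ∉ S} → Fin #S ⊕ {a // a ∉ S})

lemma forestGlue_mem (a : A) (h : a ∈ S) : forestGlue S f w a = Sum.inl (f ⟨a, h⟩) := by
  simp [forestGlue, h]

lemma forestGlue_notMem (a : A) (h : a ∉ S) :
    forestGlue S f w a = Sum.inr (levelVertex S (w ⟨a, h⟩)) := by
  simp [forestGlue, h]

lemma isLeft_forestGlue_iff (a : A) : (forestGlue S f w a).isLeft ↔ a ∈ S := by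
  by_cases h : a ∈ S
  · simp [forestGlue_mem S f w a h, h]
  · simp [forestGlue_notMem S f w a h, h]

/-- A height function restricts to the rest; conversely, heights on the rest are raised by one to
make room for height 0 on S. -/
lemma isForestMap_forestGlue : IsForestMap (forestGlue S f w) ↔ IsForestMap w := by
  constructor
  · rintro ⟨h, hh⟩
    refine ⟨fun a => h a, fun a b hab => hh _ _ ?_⟩
    rw [forestGlue_notMem S f w a a.2, hab]
    rfl
  · rintro ⟨h, hh⟩
    refine ⟨fun a => if ha : a ∈ S then 0 else h ⟨a, ha⟩ + 1, fun a b hab => ?_⟩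
    by_cases ha : a ∈ S
    · simp [forestGlue_mem S f w a ha] at hab
    · rw [forestGlue_notMem S f w a ha, Sum.inr.injEq] at hab
      by_cases hb : b ∈ S
      · simp [ha, hb]
      · simp only [ha, hb, dif_neg, not_false_eq_true, add_lt_add_iff_right]
        refine hh _ _ (levelVertex_injective S ?_)
        rw [hab]
        rfl

end

/-- Forests form a level model. -/
noncomputable def forestModel : LevelModel where
  Obj k A := {p : A → Fin k ⊕ A // IsForestMap p}
  finite k A _ := inferInstance
  glue S f w := ⟨forestGlue S f w.1, (isForestMap_forestGlue S f w.1).2 w.2⟩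
  glue_bijective k A _ := by
    constructor
    · rintro ⟨S, f, w⟩ ⟨T, g, v⟩ h
      have h' : forestGlue S f w.1 = forestGlue T g v.1 := congrArg Subtype.val h
      obtain rfl : S = T := by
        ext a
        rw [← isLeft_forestGlue_iff S f w.1, h', isLeft_forestGlue_iff]
      have hf : f = g := funext fun a => Sum.inl_injective (by
        rw [← forestGlue_mem S f w.1 a a.2, h', forestGlue_mem S g v.1 a a.2])
      have hw : w = v := Subtype.ext (funext fun a => by
        have := congrFun h' a.1
        rw [forestGlue_notMem S f w.1 a a.2, forestGlue_notMem S g v.1 a a.2] at this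
        exact levelVertex_injective S (Sum.inr_injective this))
      rw [hf, hw]
    · rintro ⟨p, hp⟩
      let S : Finset A := {a | (p a).isLeft}
      have hS : ∀ a, a ∈ S ↔ (p a).isLeft := by simp [S]
      let f : S → Fin k := fun a => (p a).getLeft ((hS _).1 a.2)
      choose v hv using levelVertex_surjective S
      have hr : ∀ a, a ∉ S → (p a).isRight := by
        intro a ha
        rw [hS] at ha
        simpa using ha
      let w : {a // a ∉ S} → Fin #S ⊕ {a // a ∉ S} := fun a => v ((p a).getRight (hr a a.2))
      have h : forestGlue S f w = p := by
        funext a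
        by_cases ha : a ∈ S
        · rw [forestGlue_mem S f w a ha]
          simp [f]
        · rw [forestGlue_notMem S f w a ha]
          simp [w, hv]
      exact ⟨⟨S, f, w, (isForestMap_forestGlue S f w).1 (h ▸ hp)⟩, Subtype.ext h⟩
  card_of_isEmpty k A _ _ := by
    rw [Nat.card_eq_one_iff_unique]
    exact ⟨⟨fun π ρ => Subtype.ext (Subsingleton.elim _ _)⟩,
      ⟨⟨isEmptyElim, fun _ => 0, fun a => isEmptyElim a⟩⟩⟩
  isEmpty_zero A _ _ := ⟨fun p => by
    obtain ⟨p, h, hh⟩ := p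
    -- A vertex of minimal height can only have a root as parent, and there are none.
    obtain ⟨a, -, ha⟩ := exists_min_image univ h univ_nonempty
    rcases hp : p a with c | b
    · exact c.elim0
    · exact not_lt.2 (ha b (mem_univ b)) (hh a b hp)⟩
  lev {k A} _ p := #{a | (p.1 a).isLeft}
  lel p a := #{b | p.1 b = p.1 a}
  lev_glue S f w := by simp [isLeft_forestGlue_iff]
  lel_glue_mem S f w a h := by
    refine card_fiber_mem S (forestGlue S f w.1) f ?_ ?_ a h
    · intro a b
      rw [forestGlue_mem _ _ _ _ a.2, forestGlue_mem _ _ _ _ b.2, Sum.inl.injEq]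
    · intro a b h ha
      rwa [← isLeft_forestGlue_iff S f w.1, ← h, isLeft_forestGlue_iff]
  lel_glue_notMem S f w a h := by
    convert card_fiber_notMem S (forestGlue S f w.1) w.1 ?_ ?_ a h
    · intro a b
      rw [forestGlue_notMem _ _ _ _ a.2, forestGlue_notMem _ _ _ _ b.2, Sum.inr.injEq,
        (levelVertex_injective S).eq_iff]
    · intro a b h ha
      rwa [← isLeft_forestGlue_iff S f w.1, ← h, isLeft_forestGlue_iff]

/-! ### Graphs of parent maps -/

section ParentGraph

variable {C A : Type} {p : A → C ⊕ A}

/-- The relation between a non-root vertex and its parent. -/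
def ParentStep (p : A → C ⊕ A) (u v : C ⊕ A) : Prop := ∃ a, u = Sum.inr a ∧ p a = v

/-- The graph of a parent map. -/
def parentGraph (p : A → C ⊕ A) : SimpleGraph (C ⊕ A) := SimpleGraph.fromRel (ParentStep p)

/-- `w` is `v` or a descendant of `v`. -/
def IsDescendant (p : A → C ⊕ A) (v w : C ⊕ A) : Prop :=
  Relation.ReflTransGen (ParentStep p) w v

lemma exists_height (hp : IsForestMap p) :
    ∃ H : C ⊕ A → ℕ, ∀ u v, ParentStep p u v → H v < H u := by
  obtain ⟨h, hh⟩ := hp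
  refine ⟨Sum.elim (fun _ => 0) fun a => h a + 1, ?_⟩
  rintro _ v ⟨a, rfl, hv⟩
  rcases v with c | b
  · simp
  · simpa using hh a b hv

lemma parentStep_ne (hp : IsForestMap p) {u v : C ⊕ A} (h : ParentStep p u v) : u ≠ v := by
  obtain ⟨H, hH⟩ := exists_height hp
  rintro rfl
  exact lt_irrefl _ (hH _ _ h)

lemma parentGraph_adj (hp : IsForestMap p) (a : A) : (parentGraph p).Adj (p a) (Sum.inr a) := by
  have : ParentStep p (Sum.inr a) (p a) := ⟨a, rfl, rfl⟩
  exact (SimpleGraph.fromRel_adj _ _ _).2 ⟨(parentStep_ne hp this).symm, Or.inr this⟩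

lemma not_isDescendant_parent (hp : IsForestMap p) (a : A) :
    ¬ IsDescendant p (Sum.inr a) (p a) := by
  obtain ⟨H, hH⟩ := exists_height hp
  intro h
  have hle : ∀ u v, Relation.ReflTransGen (ParentStep p) u v → H v ≤ H u := by
    intro u v huv
    induction huv with
    | refl => exact le_rfl
    | tail _ hs ih => exact (hH _ _ hs).le.trans ih
  exact absurd (hH _ _ ⟨a, rfl, rfl⟩) (not_lt.2 (hle _ _ h))

/-- An edge which enters the set of descendants of `v` is the edge from the parent of `v`. -/
lemma eq_of_adj_of_isDescendant {u v w : C ⊕ A} (hadj : (parentGraph p).Adj u w)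
    (hu : ¬ IsDescendant p v u) (hw : IsDescendant p v w) :
    w = v ∧ ∃ a, v = Sum.inr a ∧ u = p a := by
  obtain ⟨-, h | h⟩ := (SimpleGraph.fromRel_adj _ _ _).1 hadj
  · exact absurd (Relation.ReflTransGen.head h hw) hu
  · rcases Relation.ReflTransGen.cases_head hw with rfl | ⟨z, hz, hzv⟩
    · obtain ⟨a, ha, hpa⟩ := h
      exact ⟨rfl, a, ha, hpa.symm⟩
    · obtain ⟨a, rfl, rfl⟩ := h
      obtain ⟨b, hb, rfl⟩ := hz
      obtain rfl := Sum.inr_injective hb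
      exact absurd hzv hu

/-- Every edge is a bridge: a walk from the parent of a to a must enter the set of descendants of a,
and the edge between them is the only entrance. -/
lemma isAcyclic_parentGraph (hp : IsForestMap p) : (parentGraph p).IsAcyclic := by
  have key : ∀ a, ¬ ((parentGraph p).deleteEdges {s(p a, Sum.inr a)}).Reachable
      (p a) (Sum.inr a) := by
    rintro a ⟨q⟩
    obtain ⟨d, -, hd1, hd2⟩ := q.exists_boundary_dart {u | ¬ IsDescendant p (Sum.inr a) u}
      (not_isDescendant_parent hp a) (fun h => h Relation.ReflTransGen.refl)
    have hadj := d.adj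
    rw [SimpleGraph.deleteEdges_adj] at hadj
    obtain ⟨h1, b, hb, h2⟩ := eq_of_adj_of_isDescendant hadj.1 hd1 (not_not.1 hd2)
    obtain rfl := Sum.inr_injective hb
    exact hadj.2 (by rw [h1, h2]; rfl)
  rw [SimpleGraph.isAcyclic_iff_forall_adj_isBridge]
  intro u v hadj
  rw [SimpleGraph.isBridge_iff]
  obtain ⟨-, ⟨a, rfl, rfl⟩ | ⟨a, rfl, rfl⟩⟩ := (SimpleGraph.fromRel_adj _ _ _).1 hadj
  · rw [Sym2.eq_swap]
    exact fun h => key a h.symm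
  · exact key a

lemma exists_reachable_root (hp : IsForestMap p) (v : C ⊕ A) :
    ∃ r, (parentGraph p).Reachable (Sum.inl r) v := by
  obtain ⟨H, hH⟩ := exists_height hp
  induction hn : H v using Nat.strong_induction_on generalizing v with
  | _ n ih =>
    rcases v with r | a
    · exact ⟨r, SimpleGraph.Reachable.refl _⟩
    · obtain ⟨r, hr⟩ := ih (H (p a)) (hn ▸ hH _ _ ⟨a, rfl, rfl⟩) (p a) rfl
      exact ⟨r, hr.trans (parentGraph_adj hp a).reachable⟩

lemma eq_of_isDescendant_root {v : C ⊕ A} {r : C} (h : IsDescendant p v (Sum.inl r)) :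
    v = Sum.inl r := by
  rcases Relation.ReflTransGen.cases_head h with h | ⟨z, ⟨a, ha, -⟩, -⟩
  · exact h.symm
  · exact absurd ha (by simp)

/-- A root has no parent, so the set of its descendants cannot be entered from outside. -/
lemma eq_of_reachable_roots {r r' : C}
    (h : (parentGraph p).Reachable (Sum.inl r) (Sum.inl r')) : r = r' := by
  obtain ⟨q⟩ := h
  by_contra hne
  obtain ⟨d, -, hd1, hd2⟩ := q.exists_boundary_dart {u | ¬ IsDescendant p (Sum.inl r') u}
    (fun h => hne (Sum.inl_injective (eq_of_isDescendant_root h)).symm)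
    (fun h => h Relation.ReflTransGen.refl)
  obtain ⟨-, b, hb, -⟩ := eq_of_adj_of_isDescendant d.adj hd1 (not_not.1 hd2)
  exact absurd hb (by simp)

/-- A shortest walk from the root to a enters the descendants of a through `p a`; stopping there
gives a strictly shorter walk. -/
lemma dist_parentGraph (hp : IsForestMap p) (r : C) (a : A)
    (hr : (parentGraph p).Reachable (Sum.inl r) (Sum.inr a)) :
    (parentGraph p).dist (Sum.inl r) (Sum.inr a) = (parentGraph p).dist (Sum.inl r) (p a) + 1 := by
  have hadj := parentGraph_adj hp a
  apply le_antisymm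
  · obtain ⟨q, hq⟩ := (hr.trans hadj.symm.reachable).exists_walk_length_eq_dist
    rw [← hq, ← SimpleGraph.Walk.length_concat q hadj]
    exact SimpleGraph.dist_le _
  · obtain ⟨q, hq⟩ := hr.exists_walk_length_eq_dist
    obtain ⟨d, hd, hd1, hd2⟩ := q.exists_boundary_dart {u | ¬ IsDescendant p (Sum.inr a) u}
      (fun h => absurd (eq_of_isDescendant_root h) (by simp))
      (fun h => h Relation.ReflTransGen.refl)
    obtain ⟨-, b, hb, h2⟩ := eq_of_adj_of_isDescendant d.adj hd1 (not_not.1 hd2)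
    obtain rfl := Sum.inr_injective hb
    have hmem : p a ∈ q.support := h2 ▸ q.dart_fst_mem_support_of_mem_darts hd
    rw [← hq]
    exact (SimpleGraph.dist_le _).trans_lt
      (SimpleGraph.Walk.length_takeUntil_lt_length hmem hadj.ne)

end ParentGraph

/-! ### Rooted forests and parent maps -/

namespace RootedForest

variable {m n : ℕ}

/-- The rooted forest with a given parent map. -/
def ofParent (p : Fin m → Vertex m n) (hp : IsForestMap p) : RootedForest m n where
  graph := parentGraph p
  acyclic := isAcyclic_parentGraph hp
  existsUnique_root v := by
    obtain ⟨r, hr⟩ := exists_reachable_root hp v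
    exact ⟨r, hr, fun r' hr' => eq_of_reachable_roots (hr'.trans hr.symm)⟩

lemma isParent_parent (F : RootedForest m n) (i : Fin m) : F.IsParent (F.parent i) (Sum.inr i) :=
  (F.existsUnique_parent i).choose_spec.1

lemma isParent_inr_iff (F : RootedForest m n) (v : Vertex m n) (i : Fin m) :
    F.IsParent v (Sum.inr i) ↔ F.parent i = v :=
  ⟨fun h => (F.existsUnique_parent i).unique (F.isParent_parent i) h,
    fun h => h ▸ F.isParent_parent i⟩

lemma not_isParent_inl (F : RootedForest m n) (v : Vertex m n) (r : Fin (n - m + 1)) :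
    ¬ F.IsParent v (Sum.inl r) := by
  rintro ⟨-, r', hr', hd⟩
  obtain rfl : r' = r :=
    (F.existsUnique_root (Sum.inl r)).unique hr' (SimpleGraph.Reachable.refl _)
  simp at hd

lemma parent_ofParent (p : Fin m → Vertex m n) (hp : IsForestMap p) :
    (ofParent p hp).parent = p := by
  funext i
  rw [← isParent_inr_iff]
  obtain ⟨r, hr⟩ := exists_reachable_root hp (Sum.inr i)
  exact ⟨parentGraph_adj hp i, r, hr, dist_parentGraph hp r i hr⟩

/-- The distance to the root of its own tree serves as the height of a vertex. -/
lemma isForestMap_parent (F : RootedForest m n) : IsForestMap F.parent := by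
  choose r hr hu using F.existsUnique_root
  refine ⟨fun i => F.graph.dist (Sum.inl (r (Sum.inr i))) (Sum.inr i), fun i j hij => ?_⟩
  obtain ⟨hadj, r', hr', hd⟩ := F.isParent_parent i
  rw [hij] at hadj hd
  obtain rfl := hu _ _ hr'
  have : r (Sum.inr i) = r (Sum.inr j) := hu _ _ ((hr _).trans hadj.symm.reachable)
  simp only
  rw [← this, hd]
  exact Nat.lt_succ_self _

/-- The parent edges form a subgraph with the same components: each vertex is joined to a root
inside it, and `F` has only one root per component. An acyclic subgraph with the same reachability
is maximal acyclic, hence is all of the forest. -/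
lemma parentGraph_parent (F : RootedForest m n) : parentGraph F.parent = F.graph := by
  have hp := F.isForestMap_parent
  have hle : parentGraph F.parent ≤ F.graph := by
    intro u v hadj
    obtain ⟨-, ⟨i, rfl, rfl⟩ | ⟨i, rfl, rfl⟩⟩ := (SimpleGraph.fromRel_adj _ _ _).1 hadj
    · exact (F.isParent_parent i).1.symm
    · exact (F.isParent_parent i).1
  have hreach : (parentGraph F.parent).Reachable = F.graph.Reachable := by
    funext u v
    refine propext ⟨fun h => h.mono hle, fun h => ?_⟩
    obtain ⟨r, hr⟩ := exists_reachable_root hp u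
    obtain ⟨s, hs⟩ := exists_reachable_root hp v
    obtain rfl : r = s := (F.existsUnique_root v).unique ((hr.mono hle).trans h) (hs.mono hle)
    exact hr.symm.trans hs
  have hmax := (SimpleGraph.maximal_isAcyclic_iff_reachable_eq hle
    (isAcyclic_parentGraph hp)).2 hreach
  exact le_antisymm hle (hmax.2 ⟨le_rfl, F.acyclic⟩ hle)

lemma deg_eq (F : RootedForest m n) (v : Vertex m n) : F.deg v = #{i | F.parent i = v} := by
  rw [deg, ← card_map (s := {i | F.parent i = v}) (Function.Embedding.inr (α := Fin (n - m + 1)))]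
  refine congrArg card ?_
  ext u
  rcases u with r | i
  · simp [not_isParent_inl]
  · simp [isParent_inr_iff]

lemma rootDeg_eq (F : RootedForest m n) : F.rootDeg = #{i | (F.parent i).isLeft} := by
  simp_rw [rootDeg, deg_eq, card_filter]
  rw [sum_comm]
  refine sum_congr rfl fun i _ => ?_
  rcases F.parent i with r | j <;> simp

end RootedForest

/-- Sums over rooted forests as sums over the level model. -/
lemma sum_rootedForest {m n : ℕ} (hm : 1 ≤ m) {R : Type*} [AddCommMonoid R] (g : ℕ → ℕ → R) :
    ∑ F : RootedForest m n, g F.rootDeg (F.parentDeg hm) =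
      ∑ p : forestModel.Obj (n - m + 1) (Fin m),
        g (forestModel.lev p) (forestModel.lel p ⟨0, hm⟩) := by
  let e : RootedForest m n → forestModel.Obj (n - m + 1) (Fin m) := fun F =>
    ⟨F.parent, F.isForestMap_parent⟩
  refine Fintype.sum_bijective e ⟨?_, ?_⟩ _ _ ?_
  · intro F G h
    have h' : F.parent = G.parent := congrArg Subtype.val h
    apply RootedForest.graph_injective
    rw [← F.parentGraph_parent, h', G.parentGraph_parent]
  · rintro ⟨p, hp⟩
    exact ⟨RootedForest.ofParent p hp, Subtype.ext (RootedForest.parent_ofParent p hp)⟩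
  · intro F
    rw [F.rootDeg_eq, RootedForest.parentDeg, F.deg_eq]
    simp [forestModel, e]

/-! ### Trinomial coefficients and extraction of coefficients -/

open Polynomial

lemma trinomial_eq_zero {k a b c : ℤ} (h : a < 0 ∨ b < 0 ∨ c < 0) : trinomial k a b c = 0 := by
  unfold trinomial
  rw [if_neg]
  omega

lemma trinomial_cast (a b c : ℕ) :
    trinomial ((a + b + c : ℕ) : ℤ) a b c = (a + b + c).choose a * (b + c).choose b := by
  unfold trinomial
  rw [if_pos (by push_cast; omega)]
  simp only [Int.toNat_natCast]
  apply Nat.div_eq_of_eq_mul_left (by positivity)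
  have h1 := Nat.add_choose_mul_factorial_mul_factorial a (b + c)
  have h2 := Nat.add_choose_mul_factorial_mul_factorial b c
  rw [← add_assoc] at h1
  rw [← h1, ← h2, Nat.choose_symm_add (a := b), add_assoc, Nat.choose_symm_add (a := a)]
  ring

/-- The level sums produce products of two binomials: here q is chosen outside the p chosen points,
in `trinomial_eq_choose_right` t is chosen inside the s chosen ones. Out of range both sides vanish.
-/
lemma trinomial_eq_choose_left (N p q : ℕ) :
    trinomial N p q ((N : ℤ) - p - q) = N.choose p * (N - p).choose q := by
  by_cases h : p + q ≤ N
  · obtain ⟨r, rfl⟩ := Nat.exists_eq_add_of_le h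
    rw [show ((p + q + r : ℕ) : ℤ) - p - q = r by push_cast; ring, trinomial_cast,
      show p + q + r - p = q + r by omega]
  · rw [trinomial_eq_zero (by omega)]
    by_cases hp : p ≤ N
    · rw [Nat.choose_eq_zero_of_lt (show N - p < q by omega), mul_zero]
    · rw [Nat.choose_eq_zero_of_lt (show N < p by omega), zero_mul]

lemma trinomial_eq_choose_right (N s t : ℕ) :
    trinomial N t ((s : ℤ) - t) ((N : ℤ) - s) = N.choose s * s.choose t := by
  by_cases h : t ≤ s ∧ s ≤ N
  · obtain ⟨q, rfl⟩ := Nat.exists_eq_add_of_le h.1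
    obtain ⟨r, rfl⟩ := Nat.exists_eq_add_of_le h.2
    rw [show ((t + q + r : ℕ) : ℤ) - (t + q : ℕ) = r by push_cast; ring,
      show ((t + q : ℕ) : ℤ) - t = q by push_cast; ring, trinomial_cast,
      Nat.choose_mul h.1]
    congr 2 <;> omega
  · rw [trinomial_eq_zero (by omega)]
    by_cases hs : s ≤ N
    · rw [Nat.choose_eq_zero_of_lt (show s < t by omega), mul_zero]
    · rw [Nat.choose_eq_zero_of_lt (show N < s by omega), zero_mul]

namespace LevelModel

variable (M : LevelModel)

/-- An indicator weight selects `lev` and a polynomial coefficient selects `lel`, which is why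
`sum_lev_lel` allows an arbitrary weight `g`. -/
lemma sum_ite_eq_coeff (k : ℕ) (A : Type) [Fintype A] (a₀ : A) (s t : ℕ) :
    ∑ π : M.Obj k A, (if M.lev π = s ∧ M.lel π a₀ = t then (1 : ℚ) else 0) =
      (∑ π : M.Obj k A, (if M.lev π = s then (1 : ℚ[X]) else 0) * X ^ M.lel π a₀).coeff t := by
  rw [finsetSum_coeff]
  refine sum_congr rfl fun π _ => ?_
  by_cases h : M.lev π = s
  · simp [h, coeff_X_pow, eq_comm]
  · simp [h]

/-- The number of structures with given `lev` and `lel`. -/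
theorem sum_ite_eq (k a : ℕ) (A : Type) [Fintype A] (hA : Fintype.card A = a + 1) (a₀ : A)
    (s t : ℕ) :
    ∑ π : M.Obj k A, (if M.lev π = s + 1 ∧ M.lel π a₀ = t + 1 then (1 : ℚ) else 0) =
      a.choose (s + 1) * k ^ (s + 1) * (s + 1) *
          ((a - (s + 1)).choose t * a ^ (a - (s + 1) - t)) +
        a.choose s * k * (s.choose t * (k - 1) ^ (s - t)) * count (s + 1) (a - s) := by
  have h1 : ∀ r : ℕ, ((X + (a : ℚ[X])) ^ r).coeff t = (r.choose t : ℚ) * (a : ℚ) ^ (r - t) := by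
    intro r
    rw [← C_eq_natCast, coeff_X_add_C_pow, mul_comm]
  have h2 : ∀ r : ℕ, ((X + (k : ℚ[X]) - 1) ^ r).coeff t =
      (r.choose t : ℚ) * ((k : ℚ) - 1) ^ (r - t) := by
    intro r
    rw [show X + (k : ℚ[X]) - 1 = X + C ((k : ℚ) - 1) by simp [add_sub_assoc],
      coeff_X_add_C_pow, mul_comm]
  rw [sum_ite_eq_coeff, M.sum_lev_lel k a A hA a₀ X fun r => if r = s + 1 then 1 else 0, coeff_add]
  congr 1
  · rw [sum_eq_single (s + 1)]
    · rw [← h1]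
      rw [show (a.choose (s + 1) : ℚ[X]) * ((if s + 1 = s + 1 then 1 else 0) * (k : ℚ[X]) ^ (s + 1) *
          (((s + 1 : ℕ) : ℚ[X]) * X * (X + (a : ℚ[X])) ^ (a - (s + 1)))) =
        C ((a.choose (s + 1) : ℚ) * k ^ (s + 1) * (s + 1)) *
          (X * (X + (a : ℚ[X])) ^ (a - (s + 1))) by simp; ring, coeff_C_mul, coeff_X_mul]
    · intro r _ hr
      simp [hr]
    · intro hs
      rw [Nat.choose_eq_zero_of_lt (by simpa using hs)]
      simp
  · rw [sum_eq_single s]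
    · rw [← h2]
      rw [show (a.choose s : ℚ[X]) * ((if s + 1 = s + 1 then 1 else 0) *
          ((k : ℚ[X]) * X * (X + (k : ℚ[X]) - 1) ^ s) * (count (s + 1) (a - s) : ℚ[X])) =
        C ((a.choose s : ℚ) * k * count (s + 1) (a - s)) *
          (X * (X + (k : ℚ[X]) - 1) ^ s) by simp; ring, coeff_C_mul, coeff_X_mul]
      ring
    · intro r _ hr
      simp [hr]
    · intro hs
      rw [Nat.choose_eq_zero_of_lt (by simpa using hs)]
      simp

/-- The joint generating function of `lev` and `lel`. -/
theorem sum_pow_mul_pow {K : Type*} [Field K] [CharZero K] (k a : ℕ) (A : Type) [Fintype A]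
    (hA : Fintype.card A = a + 1) (a₀ : A) (x y : K) (h : x * y + (k - 1) * x + 1 ≠ 0) :
    ∑ π : M.Obj k A, x ^ M.lev π * y ^ M.lel π a₀ =
      k * x * y * (a * (k * x + y + a) ^ ((a : ℤ) - 1) +
        (x * y + (k - 1) * x + 1) * (x * y + (k - 1) * x + (a + 1)) ^ ((a : ℤ) - 1)) := by
  rw [M.sum_lev_lel k a A hA a₀ y fun s => x ^ s, sum_first]
  rcases a with _ | a
  -- For a = 0 the exponent is -1: the first summand has the factor 0, and in the second the nonzero
  -- factor `h` cancels its inverse.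
  · simp [count, mul_inv_cancel₀ h]
    ring
  · rw [sum_second]
    simp only [Nat.add_sub_cancel]
    push_cast
    rw [add_sub_cancel_right, zpow_natCast, zpow_natCast, add_assoc (a : K) 1 1, one_add_one_eq_two]
    ring

end LevelModel

lemma natCard_rootedForest {m n : ℕ} (hm : 1 ≤ m) (s t : ℕ) :
    (Nat.card {F : RootedForest m n // F.rootDeg = s ∧ F.parentDeg hm = t} : ℚ) =
      ∑ p : forestModel.Obj (n - m + 1) (Fin m),
        if forestModel.lev p = s ∧ forestModel.lel p ⟨0, hm⟩ = t then (1 : ℚ) else 0 := by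
  rw [← sum_rootedForest hm fun i j => if i = s ∧ j = t then (1 : ℚ) else 0,
    Nat.card_eq_fintype_card, Fintype.card_subtype]
  simp

lemma natCard_PF {m n : ℕ} (hm : 1 ≤ m) (hmn : m ≤ n) (s t : ℕ) :
    (Nat.card {π : PF m n // slev π = s ∧ lel hm π = t} : ℚ) =
      ∑ p : parkModel.Obj (n - m + 1) (Fin m),
        if parkModel.lev p = s ∧ parkModel.lel p ⟨0, hm⟩ = t then (1 : ℚ) else 0 := by
  rw [← sum_PF hm hmn fun i j => if i = s ∧ j = t then (1 : ℚ) else 0,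
    Nat.card_eq_fintype_card, Fintype.card_subtype]
  simp

/-- The constant term is 1. This matters for m = 1, where the exponent m - 2 is negative. -/
lemma x_mul_y_add_ne_zero (k : ℕ) : x * y + ((k : RatFun) - 1) * x + 1 ≠ 0 := by
  have h : x * y + ((k : RatFun) - 1) * x + 1 = algebraMap (MvPolynomial (Fin 2) ℚ) RatFun
      (MvPolynomial.X 0 * MvPolynomial.X 1 + ((k : MvPolynomial (Fin 2) ℚ) - 1) * MvPolynomial.X 0
        + 1) := by
    simp [x, y]
  rw [h, Ne, FaithfulSMul.algebraMap_eq_zero_iff]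
  intro h0
  simpa using congrArg (MvPolynomial.eval fun _ => (0 : ℚ)) h0

end ParkingForest

/-! ### Proof of the theorem -/

open ParkingForest in
theorem theorem4p1 (m n : ℕ) (hm : 1 ≤ m) (hmn : m ≤ n) :
    -- the pairs `(deg(0), deg(p))` and `(slev, lel)` have the same joint counts
    (∀ s t : ℕ,
      Nat.card {F : RootedForest m n // F.rootDeg = s ∧ F.parentDeg hm = t} =
        Nat.card {π : PF m n // slev π = s ∧ lel hm π = t}) ∧
    -- the explicit formula for these counts
    (∀ s t : ℕ, 1 ≤ s → 1 ≤ t →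
      (Nat.card {F : RootedForest m n // F.rootDeg = s ∧ F.parentDeg hm = t} : ℚ) =
        (trinomial (m - 2) (s - 1) (t - 1) (m - s - t) : ℚ)
            * ((n : ℚ) - m + 1) ^ s * ((m : ℚ) - 1) ^ ((m : ℤ) - s - t + 1)
          + (trinomial (m - 1) (t - 1) (s - t) (m - s) : ℚ)
            * (s : ℚ) * ((n : ℚ) - m + 1) * ((n : ℚ) - m) ^ ((s : ℤ) - t)
            * (m : ℚ) ^ ((m : ℤ) - s - 1)) ∧
    -- the generating functions agree
    (∑ F : RootedForest m n, x ^ F.rootDeg * y ^ F.parentDeg hm =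
      ∑ π : PF m n, x ^ slev π * y ^ lel hm π) ∧
    -- the explicit formula for the generating function
    ∑ F : RootedForest m n, x ^ F.rootDeg * y ^ F.parentDeg hm =
      ((n : RatFun) - m + 1) * x * y *
        (((m : RatFun) - 1) * (((n : RatFun) - m + 1) * x + y + m - 1) ^ ((m : ℤ) - 2)
          + (x * y + ((n : RatFun) - m) * x + 1)
            * (x * y + ((n : RatFun) - m) * x + m) ^ ((m : ℤ) - 2)) := by
  obtain ⟨a, rfl⟩ := Nat.exists_eq_add_of_le' hm
  have hA : Fintype.card (Fin (a + 1)) = a + 1 := Fintype.card_fin _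
  refine ⟨fun s t => ?_, fun s t hs ht => ?_, ?_, ?_⟩
  · have : (Nat.card {F : RootedForest (a + 1) n // F.rootDeg = s ∧ F.parentDeg hm = t} : ℚ) =
        (Nat.card {π : PF (a + 1) n // slev π = s ∧ lel hm π = t} : ℚ) := by
      -- After the rewriting both sides are the same expression, as the distribution does not depend
      -- on the model.
      rw [natCard_rootedForest, natCard_PF hm hmn, LevelModel.sum_ite_eq_coeff,
        LevelModel.sum_ite_eq_coeff,
        forestModel.sum_lev_lel _ a _ hA _ Polynomial.X
          fun r => if r = s then (1 : Polynomial ℚ) else 0,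
        parkModel.sum_lev_lel _ a _ hA _ Polynomial.X
          fun r => if r = s then (1 : Polynomial ℚ) else 0]
    exact_mod_cast this
  · obtain ⟨s, rfl⟩ := Nat.exists_eq_add_of_le' hs
    obtain ⟨t, rfl⟩ := Nat.exists_eq_add_of_le' ht
    rw [natCard_rootedForest, forestModel.sum_ite_eq _ a _ hA]
    have hk : ((n - (a + 1) + 1 : ℕ) : ℚ) = (n : ℚ) - (a + 1 : ℕ) + 1 := by
      rw [Nat.cast_add, Nat.cast_sub hmn, Nat.cast_one]
    rw [hk, add_sub_cancel_right]
    congr 1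
    · rcases a with _ | b
      -- For m = 1 the last lower entry is negative, and no point besides the marked one exists for
      -- the first level.
      · rw [trinomial_eq_zero (by push_cast; omega)]
        simp
      · rw [show ((b + 1 + 1 : ℕ) : ℤ) - 2 = b by push_cast; ring,
          show ((s + 1 : ℕ) : ℤ) - 1 = s by push_cast; ring,
          show ((t + 1 : ℕ) : ℤ) - 1 = t by push_cast; ring,
          show ((b + 1 + 1 : ℕ) : ℤ) - (s + 1 : ℕ) - (t + 1 : ℕ) = b - s - t by push_cast; ring,
          trinomial_eq_choose_left]
        by_cases h : s + t ≤ b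
        -- Absorbing the factor s + 1 into the binomial releases b + 1 = m - 1, which accounts for
        -- the + 1 in the exponent of m - 1.
        · have h1 : ((b + 1 : ℕ) : ℚ) * (b.choose s : ℚ) =
              ((b + 1).choose (s + 1) : ℚ) * ((s + 1 : ℕ) : ℚ) := by
            exact_mod_cast congrArg (Nat.cast : ℕ → ℚ) (Nat.add_one_mul_choose_eq b s)
          rw [show (b : ℤ) - s - t + 1 = ((b - s - t + 1 : ℕ) : ℤ) by omega, zpow_natCast,
            Nat.add_sub_add_right]
          push_cast at h1 ⊢
          rw [add_sub_cancel_right, pow_succ]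
          linear_combination (-(n - ((b : ℚ) + 1 + 1) + 1) ^ (s + 1) * ((b - s).choose t : ℚ) *
            ((b : ℚ) + 1) ^ (b - s - t)) * h1
        · rw [Nat.add_sub_add_right]
          by_cases hsb : s ≤ b
          · rw [Nat.choose_eq_zero_of_lt (show b - s < t by omega)]
            simp
          · rw [Nat.choose_eq_zero_of_lt (show b < s by omega),
              Nat.choose_eq_zero_of_lt (show b + 1 < s + 1 by omega)]
            simp
    · rw [show ((a + 1 : ℕ) : ℤ) - 1 = a by push_cast; ring,
          show ((t + 1 : ℕ) : ℤ) - 1 = t by push_cast; ring,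
          show ((s + 1 : ℕ) : ℤ) - (t + 1 : ℕ) = s - t by push_cast; ring,
          show ((a + 1 : ℕ) : ℤ) - (s + 1 : ℕ) = a - s by push_cast; ring,
          trinomial_eq_choose_right]
      by_cases h : t ≤ s ∧ s ≤ a
      -- At s = a the exponent is -1 and m⁻¹ cancels s + 1 = m, matching the convention that `count`
      -- is 1 on no points.
      · have hc : (LevelModel.count (s + 1) (a - s) : ℚ) =
            ((s + 1 : ℕ) : ℚ) * ((a + 1 : ℕ) : ℚ) ^ ((a : ℤ) - s - 1) := by
          rcases h.2.eq_or_lt with rfl | hlt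
          · rw [LevelModel.count, if_pos (by omega), sub_self, zero_sub, zpow_neg_one,
              mul_inv_cancel₀ (by exact_mod_cast Nat.succ_ne_zero s), Nat.cast_one]
          · rw [LevelModel.count, if_neg (by omega),
              show (a : ℤ) - s - 1 = ((a - s - 1 : ℕ) : ℤ) by omega, zpow_natCast,
              show s + 1 + (a - s) = a + 1 by omega]
            push_cast
            ring
        rw [hc, show (s : ℤ) - t = ((s - t : ℕ) : ℤ) by omega, zpow_natCast]
        push_cast
        ring
      · by_cases hs' : s ≤ a
        · rw [Nat.choose_eq_zero_of_lt (show s < t by omega)]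
          simp
        · rw [Nat.choose_eq_zero_of_lt (show a < s by omega)]
          simp
  · rw [sum_rootedForest hm fun i j => x ^ i * y ^ j, sum_PF hm hmn fun i j => x ^ i * y ^ j,
      forestModel.sum_lev_lel _ a _ hA _ y fun r => x ^ r,
      parkModel.sum_lev_lel _ a _ hA _ y fun r => x ^ r]
  · rw [sum_rootedForest hm fun i j => x ^ i * y ^ j,
      forestModel.sum_pow_mul_pow _ a _ hA _ x y (x_mul_y_add_ne_zero _)]
    have hk : ((n - (a + 1) + 1 : ℕ) : RatFun) = (n : RatFun) - (a + 1 : ℕ) + 1 := by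
      rw [Nat.cast_add, Nat.cast_sub hmn, Nat.cast_one]
    rw [hk, show ((a + 1 : ℕ) : ℤ) - 2 = a - 1 by push_cast; ring, add_sub_cancel_right]
    push_cast
    rw [add_sub_cancel_right, add_sub_assoc _ ((a : RatFun) + 1) 1, add_sub_cancel_right]
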